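/- Let $\mathbb{YF}$ be the set of finite words over the alphabet $\{1,2\}$, with empty word $\varepsilon$. For $u,v\in\mathbb{YF}$ write $u=u'w$, $v=v'w$, where $w$ is the longest common suffix of $u$ and $v$; put $u\geqslant v$ if the number of digits $2$ in $u'$ is at least the number of digits of $v'$ (the Young–Fibonacci order). Let $\mathbf{YF}^*=\langle\mathbb{YF},\geqslant,2\rangle$ be the first-order structure with the binary relation $\geqslant$ and a constant for the one-letter word $2$. Let $p_0=2,\ p_1=3,\ p_2=5,\dots$ be the sequence of primes and let $d(v)$ be the number of digits $2$ in $v$. Define $b:\mathbb{YF}\to\mathbb N_0$ by $$ b(v)=\begin{cases} 0 & \text{if } v=\varepsilon,\\ 2^{n-1} & \text{if } v=1^n,\ n\geqslant 1,\\ p_{d(v)}^{e_{d(v)}+1}\cdot\prod_{i=0}^{d(v)-1}p_i^{e_i} & \text{if } d(v)\geqslant 1,\ v=1^{e_0}21^{e_1}2\ldots 21^{e_{d(v)-1}}21^{e_{d(v)}}\ (e_i\geqslant 0). \end{cases} $$ Then $b$ is a bijection, and the set $\{(u,1^{b(u)}) : u\in\mathbb{YF}\}\subseteq\mathbb{YF}^2$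 is definable in $\mathbf{YF}^*$ by a first-order formula without parameters. -/

import Mathlib

namespace YoungFibonacci

/-- The alphabet `{1, 2}`. -/
inductive Digit : Type
  | one : Digit
  | two : Digit
  deriving DecidableEq

/-- The vertices of the Young-Fibonacci graph: finite words over `{1, 2}`. The head of the list is
the leftmost digit, and `[]` is the empty word. -/
abbrev YF : Type := List Digit

/-- `d(v)`: the number of digits 2 of `v`. -/
def d (v : YF) : ℕ := v.count Digit.two

/-- The word `1^n`. -/
def ones (n : ℕ) : YF := List.replicate n Digit.one

/-- The word `2`. -/
def wordTwo : YF := [Digit.two]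

/-- `w` is the longest common suffix of `u` and `v`. -/
def IsLongestCommonSuffix (w u v : YF) : Prop :=
  w <:+ u ∧ w <:+ v ∧ ∀ x : YF, x <:+ u → x <:+ v → x.length ≤ w.length

/-- The Young-Fibonacci order `u ≥ v`: once the longest common suffix has been deleted,
what is left of `u` has at least as many digits 2 as what is left of `v` has digits. -/
def Geq (u v : YF) : Prop :=
  ∃ u' v' w : YF, u = u' ++ w ∧ v = v' ++ w ∧ IsLongestCommonSuffix w u v ∧ v'.length ≤ d u'

/-- Function symbols: a single constant, `2`. -/
inductive StarFunctions : ℕ → Type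
  | two : StarFunctions 0

/-- Relation symbols: a single binary relation, `≥`. -/
inductive StarRelations : ℕ → Type
  | geq : StarRelations 2

/-- The first-order language with one binary relation `≥` and one constant `2`. -/
def starLanguage : FirstOrder.Language.{0, 0} where
  Functions := StarFunctions
  Relations := StarRelations

/-- The structure `YF* = ⟨YF, ≥, 2⟩`. -/
instance starStructure : starLanguage.Structure YF where
  funMap {_} f _ :=
    match f with
    | StarFunctions.two => wordTwo
  RelMap {_} r x :=
    match r, x with
    | StarRelations.geq, x => Geq (x 0) (x 1)

/-- The `i`-th run length `e_i` in the decomposition `v = 1^{e_0} 2 1^{e_1} 2 ⋯ 2 1^{e_{d(v)}}`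
(and `0` for `i > d(v)`). -/
def run : YF → ℕ → ℕ
  | [], _ => 0
  | Digit.one :: v, 0 => run v 0 + 1
  | Digit.one :: v, i + 1 => run v (i + 1)
  | Digit.two :: _, 0 => 0
  | Digit.two :: v, i + 1 => run v i

/-- The defining decomposition `v = 1^{e_0} 2 1^{e_1} 2 ⋯ 2 1^{e_{d(v)}}`. -/
theorem eq_runs (v : YF) :
    v = ones (run v 0) ++
      (List.range (d v)).flatMap (fun i => Digit.two :: ones (run v (i + 1))) := by
  induction v with
  | nil => rfl
  | cons a v ih =>
    cases a with
    | one =>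
      have hd : d (Digit.one :: v) = d v := by simp [d]
      rw [hd]
      simp only [run, ones, List.replicate_succ, List.cons_append]
      exact congrArg _ ih
    | two =>
      have hd : d (Digit.two :: v) = d v + 1 := by simp [d]
      rw [hd, List.range_succ_eq_map, List.flatMap_cons, List.flatMap_map]
      simp only [run, ones, List.replicate_zero, List.nil_append, List.cons_append]
      exact congrArg _ ih

/-- The sequence of primes `p_0 = 2, p_1 = 3, p_2 = 5, …`. -/
noncomputable def p (i : ℕ) : ℕ := Nat.nth Nat.Prime i

/-- The map `b : YF → ℕ`. In the second case `v` is nonempty without digits 2, so `v = 1^n` with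
`n = v.length ≥ 1`. -/
noncomputable def b (v : YF) : ℕ :=
  if v = [] then 0
  else if d v = 0 then 2 ^ (v.length - 1)
  else p (d v) ^ (run v (d v) + 1) * ∏ i ∈ Finset.range (d v), p i ^ run v i

end YoungFibonacci

namespace YoungFibonacci

/-! Bijectivity is unique factorization. For nonempty `u`, `b u` is the product of the powers `p i ^
exponent u i`. When `d u > 0` the last run is raised by 1, so `d u` is the largest index with a
nonzero exponent; words `1^n` give exactly the powers of 2. Hence word and exponent sequence
determine each other (`eq_of_exponent_eq`, `exists_exponent_eq`).

For definability, the number `n` is represented by `1^n`; these are the words not above `2`, and `≥`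
restricts to the usual order on them. Three basic operations are first-order: prepending a 1 (a
matter of lower covers, `eq_cons_one_iff`), counting the 2s (through common upper bounds of `1^n`
and `1^m 2`, `joinGeq_iff`), and length (`length_le_iff`).

The decisive gain is `twoAt_iff`: the digit at a given position is definable. A word of length `n`
then codes an arbitrary subset of `{0, …, n-1}`, and its number of 2s is the size of that subset.
Quantifying over words thus quantifies over finite sets with cardinality, so counting below a bound
is definable (`eq_countBelow_iff`). Divisibility, primality, the index of a prime, run lengths and
prime exponents all follow, without defining exponentiation or coding sequences. Finally `eq_b_iff`
compares `n` with `u` one prime at a time. -/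

@[simp] theorem d_nil : d [] = 0 := rfl

@[simp] theorem d_cons_one (v : YF) : d (Digit.one :: v) = d v := by simp [d]

@[simp] theorem d_cons_two (v : YF) : d (Digit.two :: v) = d v + 1 := by simp [d]

@[simp] theorem d_append (u v : YF) : d (u ++ v) = d u + d v := by simp [d]

@[simp] theorem d_ones (n : ℕ) : d (ones n) = 0 := by simp [d, ones, List.count_replicate]

@[simp] theorem length_ones (n : ℕ) : (ones n).length = n := by simp [ones]

@[simp] theorem ones_zero : ones 0 = [] := rfl

theorem ones_succ (n : ℕ) : ones (n + 1) = Digit.one :: ones n := rfl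

theorem ones_succ' (n : ℕ) : ones (n + 1) = ones n ++ [Digit.one] := by
  simp [ones, List.replicate_succ']

theorem ones_add (m n : ℕ) : ones (m + n) = ones m ++ ones n := by simp [ones]

theorem ones_injective : Function.Injective ones := fun m n h => by
  simpa using congrArg List.length h

theorem d_le_length (u : YF) : d u ≤ u.length := List.count_le_length

theorem eq_ones_of_d_eq_zero {u : YF} (h : d u = 0) : u = ones u.length := by
  induction u with
  | nil => rfl
  | cons a u ih =>
    cases a with
    | one => rw [List.length_cons, ones_succ, ← ih (by simpa using h)]
    | two => simp at h

/-- The number of digits 1 at the right end of a word. -/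
def trailingOnes (u : YF) : ℕ := (u.reverse.takeWhile (· = Digit.one)).length

@[simp] theorem trailingOnes_nil : trailingOnes [] = 0 := rfl

@[simp] theorem trailingOnes_concat_one (u : YF) :
    trailingOnes (u ++ [Digit.one]) = trailingOnes u + 1 := by simp [trailingOnes]

@[simp] theorem trailingOnes_concat_two (u : YF) :
    trailingOnes (u ++ [Digit.two]) = 0 := by simp [trailingOnes]

@[simp] theorem trailingOnes_append_ones (u : YF) (n : ℕ) :
    trailingOnes (u ++ ones n) = trailingOnes u + n := by
  induction n with
  | zero => simp
  | succ n ih => rw [ones_succ', ← List.append_assoc, trailingOnes_concat_one, ih]; rfl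

@[simp] theorem trailingOnes_ones (n : ℕ) : trailingOnes (ones n) = n := by
  simpa using trailingOnes_append_ones [] n

theorem exists_eq_append_ones (u : YF) :
    ∃ y, u = y ++ ones (trailingOnes u) ∧ trailingOnes y = 0 := by
  induction u using List.reverseRecOn with
  | nil => exact ⟨[], rfl, rfl⟩
  | append_singleton u a ih =>
    cases a with
    | one =>
      obtain ⟨y, h, hy⟩ := ih
      refine ⟨y, ?_, hy⟩
      rw [trailingOnes_concat_one, ones_succ', ← List.append_assoc, ← h]
    | two => exact ⟨u ++ [Digit.two], by simp, by simp⟩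

theorem eq_nil_or_concat_two {y : YF} (h : trailingOnes y = 0) :
    y = [] ∨ ∃ z, y = z ++ [Digit.two] := by
  induction y using List.reverseRecOn with
  | nil => exact .inl rfl
  | append_singleton u a _ =>
    cases a with
    | one => simp at h
    | two => exact .inr ⟨u, rfl⟩

/-! ### The order, computed from the right end -/

theorem geq_nil (u : YF) : Geq u [] :=
  ⟨u, [], [], by simp, rfl, ⟨by simp, by simp, fun x _ hx => by simp_all⟩, by simp⟩

@[simp] theorem geq_concat {u v : YF} {a : Digit} : Geq (u ++ [a]) (v ++ [a]) ↔ Geq u v := by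
  constructor
  · rintro ⟨u', v', w, hu, hv, ⟨_, _, hm⟩, hd⟩
    rcases List.eq_nil_or_concat' w with rfl | ⟨w, c, rfl⟩
    · exact absurd (hm [a] (by simp) (by simp)) (by simp)
    · rw [← List.append_assoc] at hu hv
      obtain ⟨rfl, hc⟩ := List.append_inj' hu rfl
      obtain ⟨rfl, -⟩ := List.append_inj' hv rfl
      refine ⟨u', v', w, rfl, rfl, ⟨by simp, by simp, fun x hx hx' => ?_⟩, hd⟩
      have := hm (x ++ [a]) (by obtain ⟨t, ht⟩ := hx; exact ⟨t, by rw [← ht]; simp⟩)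
        (by obtain ⟨t, ht⟩ := hx'; exact ⟨t, by rw [← ht]; simp⟩)
      simpa using this
  · rintro ⟨u', v', w, rfl, rfl, ⟨_, _, hm⟩, hd⟩
    refine ⟨u', v', w ++ [a], by simp, by simp, ⟨⟨u', by simp⟩, ⟨v', by simp⟩,
      fun x hx hx' => ?_⟩, hd⟩
    rcases List.eq_nil_or_concat' x with rfl | ⟨x, c, rfl⟩
    · simp
    · obtain ⟨t, ht⟩ := hx
      obtain ⟨s, hs⟩ := hx'
      rw [← List.append_assoc] at ht hs
      have := hm x ⟨t, (List.append_inj' ht rfl).1⟩ ⟨s, (List.append_inj' hs rfl).1⟩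
      simpa using this

/-- The longest common suffix is empty here, so the definition becomes a single inequality. With
`geq_concat` this decides the order by reading both words from the right. -/
theorem geq_concat_of_ne {u v : YF} {a c : Digit} (h : a ≠ c) :
    Geq (u ++ [a]) (v ++ [c]) ↔ v.length + 1 ≤ d (u ++ [a]) := by
  have key : ∀ x : YF, x <:+ u ++ [a] → x <:+ v ++ [c] → x = [] := by
    intro x hx hx'
    rcases List.eq_nil_or_concat' x with rfl | ⟨x, e, rfl⟩
    · rfl
    · obtain ⟨t, ht⟩ := hx
      obtain ⟨s, hs⟩ := hx'
      rw [← List.append_assoc] at ht hs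
      have h1 := (List.append_inj' ht rfl).2
      have h2 := (List.append_inj' hs rfl).2
      simp_all
  constructor
  · rintro ⟨u', v', w, hu, hv, ⟨h1, h2, -⟩, hd⟩
    obtain rfl := key w h1 h2
    rw [List.append_nil] at hu hv
    rw [hu]
    simpa [← hv] using hd
  · intro hd
    exact ⟨u ++ [a], v ++ [c], [], by simp, by simp,
      ⟨by simp, by simp, fun x hx hx' => by simp [key x hx hx']⟩, by simpa using hd⟩

@[simp] theorem geq_append {u v w : YF} : Geq (u ++ w) (v ++ w) ↔ Geq u v := by
  induction w using List.reverseRecOn with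
  | nil => simp
  | append_singleton w a ih => rw [← List.append_assoc, ← List.append_assoc, geq_concat, ih]

@[simp] theorem nil_geq {v : YF} : Geq [] v ↔ v = [] := by
  constructor
  · rintro ⟨u', v', w, hu, hv, -, hd⟩
    obtain ⟨rfl, rfl⟩ := List.append_eq_nil_iff.1 hu.symm
    simpa [hv] using hd
  · rintro rfl
    exact geq_nil _

theorem Geq.refl (u : YF) : Geq u u := by simpa using (geq_append (w := u)).2 (geq_nil [])

theorem geq_append_right (u w : YF) : Geq (u ++ w) w := by
  simpa using (geq_append (w := w)).2 (geq_nil u)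

/-- Simultaneous induction on two words from the right. -/
theorem reverse_induction₂ {P : YF → YF → Prop} (nil_right : ∀ u, P u [])
    (nil_left : ∀ v a, P [] (v ++ [a])) (same : ∀ u v a, P u v → P (u ++ [a]) (v ++ [a]))
    (ne : ∀ u v a c, a ≠ c → P (u ++ [a]) (v ++ [c])) (u v : YF) : P u v := by
  induction v using List.reverseRecOn generalizing u with
  | nil => exact nil_right u
  | append_singleton v c ih =>
    rcases List.eq_nil_or_concat' u with rfl | ⟨u, a, rfl⟩
    · exact nil_left v c
    · by_cases h : a = c
      · exact h ▸ same u v a (ih u)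
      · exact ne u v a c h

/-- Cancelling a common last digit costs `v` one digit and `u` at most one 2, so the inequality
survives until the words differ. -/
theorem geq_of_length_le_d {u v : YF} : v.length ≤ d u → Geq u v := by
  induction u, v using reverse_induction₂ with
  | nil_right u => exact fun _ => geq_nil u
  | nil_left v a => simp
  | same u v a ih =>
    intro h
    refine geq_concat.2 (ih ?_)
    simp only [List.length_append, d_append, List.length_singleton] at h
    have := d_le_length [a]
    simp only [List.length_singleton] at this
    omega
  | ne u v a c hac =>
    intro h
    exact (geq_concat_of_ne hac).2 (by simpa using h)

/-- Length plus number of 2s is the digit sum, a rank that strictly increases along the order;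
antisymmetry follows. -/
theorem Geq.eq_or_length_add_d_lt {u v : YF} :
    Geq u v → u = v ∨ v.length + d v < u.length + d u := by
  induction u, v using reverse_induction₂ with
  | nil_right u =>
    intro
    cases u with
    | nil => exact .inl rfl
    | cons a u => right; simp
  | nil_left v a => simp
  | same u v a ih =>
    intro h
    rcases ih (geq_concat.1 h) with rfl | h
    · exact .inl rfl
    · right; simp only [List.length_append, d_append]; omega
  | ne u v a c hac =>
    intro h
    rw [geq_concat_of_ne hac] at h
    right
    have h1 := d_le_length v
    have h2 := d_le_length u
    cases a <;> cases c <;> simp at hac h ⊢ <;> omega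

theorem Geq.antisymm {u v : YF} (h : Geq u v) (h' : Geq v u) : u = v := by
  rcases h.eq_or_length_add_d_lt with h | h
  · exact h
  rcases h'.eq_or_length_add_d_lt with h' | h'
  · exact h'.symm
  · omega

theorem Geq.d_le {u v : YF} : Geq u v → d v ≤ d u := by
  induction u, v using reverse_induction₂ with
  | nil_right u => simp
  | nil_left v a => simp
  | same u v a ih =>
    intro h
    have := ih (geq_concat.1 h)
    simp only [d_append]; omega
  | ne u v a c hac =>
    intro h
    rw [geq_concat_of_ne hac] at h
    have h1 := d_le_length (v ++ [c])
    rw [List.length_append, List.length_singleton] at h1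
    omega

/-- The only lower cover of `1u` is `u`. -/
theorem cons_one_geq {u v : YF} :
    Geq (Digit.one :: u) v ↔ v = Digit.one :: u ∨ Geq u v := by
  induction u, v using reverse_induction₂ with
  | nil_right u => simp [geq_nil]
  | nil_left v a =>
    have h := geq_concat_of_ne (u := []) (v := v) (a := .one) (c := .two) (by decide)
    have h' := geq_concat (u := []) (v := v) (a := .one)
    cases a
    · simp_all
    · have : v ++ [Digit.two] ≠ [Digit.one] := fun e => by
        have := (List.append_inj' (s₁ := v) (s₂ := []) e rfl).2
        simp at this
      simpa [this] using h
  | same u v a ih =>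
    rw [← List.cons_append, geq_concat, geq_concat, ih, List.append_left_inj]
  | ne u v a c hac =>
    rw [← List.cons_append, geq_concat_of_ne hac, geq_concat_of_ne hac]
    have : v ++ [c] ≠ Digit.one :: u ++ [a] := fun h => by
      have := (List.append_inj' h rfl).2
      simp_all
    simp only [this, false_or]
    simp

theorem geq_ones {u : YF} {n : ℕ} : Geq u (ones n) ↔ n ≤ d u + trailingOnes u := by
  induction u using List.reverseRecOn generalizing n with
  | nil => cases n <;> simp [ones_succ]
  | append_singleton u a ih =>
    cases n with
    | zero => simp [geq_nil]
    | succ n =>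
      rw [ones_succ']
      cases a with
      | one => rw [geq_concat, ih]; simp; omega
      | two => rw [geq_concat_of_ne (by decide)]; simp

theorem ones_geq_ones {m n : ℕ} : Geq (ones m) (ones n) ↔ n ≤ m := by simp [geq_ones]

theorem geq_wordTwo {u : YF} : Geq u wordTwo ↔ d u ≠ 0 := by
  constructor
  · intro h
    have := h.d_le
    simp [wordTwo] at this
    omega
  · intro h
    exact geq_of_length_le_d (by simp [wordTwo]; omega)

/-! ### A calculus of definable predicates and functions -/

/-- A predicate on assignments is definable if it is the realization of a first-order formula. -/
def Def {α : Type} (P : (α → YF) → Prop) : Prop :=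
  ∃ φ : starLanguage.Formula α, ∀ v, φ.Realize v ↔ P v

/-- A word-valued function of assignments is definable if its graph is. -/
def DefFun {α : Type} (t : (α → YF) → YF) : Prop :=
  Def fun v : Option α → YF => v none = t fun a => v (some a)

/-- A number-valued function is definable if it is so after identifying `n` with `1^n`. -/
def DefNat {α : Type} (t : (α → YF) → ℕ) : Prop := DefFun fun v => ones (t v)

/-- The relation symbol `≥`. -/
def geqSymbol : starLanguage.Relations 2 := StarRelations.geq

/-- The constant symbol `2`. -/
def twoSymbol : starLanguage.Constants := StarFunctions.two

section

variable {α β : Type}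

theorem Def.congr {P Q : (α → YF) → Prop} (h : Def P) (e : ∀ v, Q v ↔ P v) : Def Q := by
  obtain ⟨φ, hφ⟩ := h
  exact ⟨φ, fun v => (hφ v).trans (e v).symm⟩

theorem Def.reindex {P : (α → YF) → Prop} (h : Def P) (g : α → β) :
    Def fun v : β → YF => P fun a => v (g a) := by
  obtain ⟨φ, hφ⟩ := h
  exact ⟨φ.relabel g, fun v => by
    rw [FirstOrder.Language.Formula.realize_relabel]; exact hφ _⟩

theorem Def.not {P : (α → YF) → Prop} (h : Def P) : Def fun v => ¬ P v := by
  obtain ⟨φ, hφ⟩ := h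
  exact ⟨φ.not, fun v => by rw [FirstOrder.Language.Formula.realize_not, hφ]⟩

theorem Def.and {P Q : (α → YF) → Prop} (h : Def P) (h' : Def Q) : Def fun v => P v ∧ Q v := by
  obtain ⟨φ, hφ⟩ := h
  obtain ⟨ψ, hψ⟩ := h'
  exact ⟨φ ⊓ ψ, fun v => by rw [FirstOrder.Language.Formula.realize_inf, hφ, hψ]⟩

theorem Def.or {P Q : (α → YF) → Prop} (h : Def P) (h' : Def Q) : Def fun v => P v ∨ Q v :=
  (h.not.and h'.not).not.congr fun v => by tauto

theorem Def.imp {P Q : (α → YF) → Prop} (h : Def P) (h' : Def Q) : Def fun v => P v → Q v :=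
  (h.and h'.not).not.congr fun v => by tauto

theorem Def.iff {P Q : (α → YF) → Prop} (h : Def P) (h' : Def Q) : Def fun v => P v ↔ Q v :=
  ((h.imp h').and (h'.imp h)).congr fun v => by tauto

/-- The extra element `none` of `Option α` plays the bound variable; relabelling sends it to the
quantified `Unit` index. -/
theorem Def.ex {P : (α → YF) → YF → Prop}
    (h : Def fun v : Option α → YF => P (fun a => v (some a)) (v none)) :
    Def fun v => ∃ x, P v x := by
  obtain ⟨φ, hφ⟩ := h
  refine ⟨(φ.relabel fun o =>
      o.elim (Sum.inr ()) Sum.inl : starLanguage.Formula (α ⊕ Unit)).iExs Unit,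
    fun v => ?_⟩
  rw [FirstOrder.Language.Formula.realize_iExs]
  simp only [FirstOrder.Language.Formula.realize_relabel, hφ]
  exact ⟨fun ⟨i, hi⟩ => ⟨i (), hi⟩, fun ⟨x, hx⟩ => ⟨fun _ => x, hx⟩⟩

theorem Def.all {P : (α → YF) → YF → Prop}
    (h : Def fun v : Option α → YF => P (fun a => v (some a)) (v none)) :
    Def fun v => ∀ x, P v x :=
  (Def.ex (P := fun v x => ¬ P v x) h.not).not.congr fun v => by simp

theorem Def.var_eq (i j : α) : Def fun v => v i = v j :=
  ⟨(FirstOrder.Language.Term.var i).equal (FirstOrder.Language.Term.var j), fun v => by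
    simp [FirstOrder.Language.Formula.realize_equal]⟩

theorem Def.var_geq (i j : α) : Def fun v => Geq (v i) (v j) :=
  ⟨geqSymbol.formula₂ (FirstOrder.Language.Term.var i) (FirstOrder.Language.Term.var j), fun v => by
    rw [FirstOrder.Language.Formula.realize_rel₂]
    exact Iff.rfl⟩

theorem DefFun.wordTwo : DefFun fun _ : α → YF => wordTwo :=
  ⟨(FirstOrder.Language.Term.var none).equal twoSymbol.term, fun v => by
    rw [FirstOrder.Language.Formula.realize_equal, FirstOrder.Language.Term.realize_constants]
    exact Iff.rfl⟩

theorem DefFun.var (i : α) : DefFun fun v => v i := Def.var_eq none (some i)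

theorem DefFun.reindex {t : (α → YF) → YF} (h : DefFun t) (g : α → β) :
    DefFun fun v : β → YF => t fun a => v (g a) :=
  (Def.reindex h (Option.map g) :)

theorem DefFun.congr {s t : (α → YF) → YF} (h : DefFun s) (e : ∀ v, t v = s v) : DefFun t := by
  rwa [show t = s from funext e]

theorem Def.subst {P : (α → YF) → YF → Prop} {t : (α → YF) → YF}
    (h : Def fun v : Option α → YF => P (fun a => v (some a)) (v none)) (ht : DefFun t) :
    Def fun v => P v (t v) :=
  (Def.ex (P := fun v x => x = t v ∧ P v x) (Def.and ht h)).congr fun v => by simp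

theorem Def.eq {s t : (α → YF) → YF} (hs : DefFun s) (ht : DefFun t) : Def fun v => s v = t v :=
  Def.subst (P := fun v x => x = t v) ht hs

theorem Def.geq {s t : (α → YF) → YF} (hs : DefFun s) (ht : DefFun t) :
    Def fun v => Geq (s v) (t v) :=
  Def.subst (P := fun v x => Geq x (t v)) (Def.subst (P := fun v x => Geq (v none) x)
    (Def.var_geq (some none) none) (ht.reindex some)) hs

/-- A function whose graph is described by a definable relation is definable. -/
theorem DefFun.of_def {P : (α → YF) → YF → Prop} {t : (α → YF) → YF}
    (h : Def fun v : Option α → YF => P (fun a => v (some a)) (v none))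
    (e : ∀ v x, x = t v ↔ P v x) : DefFun t :=
  h.congr fun _ => e _ _

theorem DefFun.nil : DefFun fun _ : α → YF => ([] : YF) :=
  DefFun.of_def (P := fun _ x => ∀ y, Geq y x) (.all (.geq (.var _) (.var _))) fun _ _ =>
    ⟨fun h y => h ▸ geq_nil y, fun h => nil_geq.1 (h [])⟩

end

/-! ### Prepending a 1 -/

/-- A word has the form `1v` when everything strictly below it lies below `v`. A word starting with
2 has at least two lower covers, except `2` itself, whose only lower cover is `1`; hence the
constant is excluded. -/
theorem eq_cons_one_iff {x v : YF} : x = Digit.one :: v ↔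
    x ≠ wordTwo ∧ Geq x v ∧ x ≠ v ∧ ∀ y, Geq x y → y ≠ x → Geq v y := by
  constructor
  · rintro rfl
    refine ⟨by simp [wordTwo], cons_one_geq.2 (.inr (.refl v)), by simp, fun y h h' => ?_⟩
    exact (cons_one_geq.1 h).resolve_left h'
  · rintro ⟨h2, hv, hne, H⟩
    match x with
    | [] => exact absurd (nil_geq.1 hv).symm hne
    | .one :: x =>
      have h1 := (cons_one_geq.1 hv).resolve_left (Ne.symm hne)
      rw [h1.antisymm (H x (cons_one_geq.2 (.inr (.refl x))) (by simp))]
    | [.two] => exact absurd rfl h2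
    | .two :: a :: x =>
      -- By rank, an element one level below `x` can only be `v`; two distinct such elements give a
      -- contradiction.
      have lower : ∀ y, Geq (.two :: a :: x) y →
          y.length + d y + 1 = (Digit.two :: a :: x).length + d (Digit.two :: a :: x) → v = y := by
        intro y hy hr
        have h1 := H y hy (by rintro rfl; omega)
        have h2 := hv.eq_or_length_add_d_lt.resolve_left hne
        exact h1.eq_or_length_add_d_lt.resolve_right (by omega)
      have hone := lower (.one :: a :: x)
        ((geq_append (u := [.two]) (v := [.one]) (w := a :: x)).2
          (geq_of_length_le_d (by simp))) (by simp; omega)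
      cases a with
      | one =>
        have := lower (.two :: x) ((geq_append (u := [.two, .one]) (v := [.two]) (w := x)).2
          (geq_of_length_le_d (by simp))) (by simp; omega)
        simp_all
      | two =>
        have := lower (.two :: .one :: x)
          ((geq_append (u := [.two, .two]) (v := [.two, .one]) (w := x)).2
          (geq_of_length_le_d (by simp))) (by simp; omega)
        simp_all

section

variable {α β : Type}

theorem Def.ne {s t : (α → YF) → YF} (hs : DefFun s) (ht : DefFun t) : Def fun v => s v ≠ t v :=
  (Def.eq hs ht).not

theorem DefFun.cons_one {t : (α → YF) → YF} (ht : DefFun t) :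
    DefFun fun v => Digit.one :: t v :=
  have ht' := ht.reindex some
  DefFun.of_def
    (P := fun v x => x ≠ YoungFibonacci.wordTwo ∧ Geq x (t v) ∧ x ≠ t v ∧
      ∀ y, Geq x y → y ≠ x → Geq (t v) y)
    (.and (.ne (.var _) .wordTwo) <| .and (.geq (.var _) ht') <| .and (.ne (.var _) ht') <|
      .all <| .imp (.geq (.var _) (.var _)) <| .imp (.ne (.var _) (.var _)) <|
        .geq (ht.reindex fun a => some (some a)) (.var _))
    fun _ _ => eq_cons_one_iff

end

/-! ### Number of 2s and length -/

/-- The last digit of `u` differs from that of `1^m 2` or cannot help against `1^n`, so one of the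
two lengths is bounded by `d u`. -/
theorem geq_ones_concat_two {u : YF} {n m : ℕ} (h : Geq u (ones n))
    (h' : Geq u (ones m ++ [Digit.two])) : min n (m + 1) ≤ d u := by
  rcases List.eq_nil_or_concat' u with rfl | ⟨u, a, rfl⟩
  · simp at h'
  · cases a with
    | one =>
      rw [geq_concat_of_ne (by decide)] at h'
      simp at h' ⊢; omega
    | two =>
      rw [geq_ones] at h
      simp at h ⊢; omega

/-- Every common upper bound of `x` and `y` is an upper bound of `z`. -/
def JoinGeq (x y z : YF) : Prop := ∀ u, Geq u x → Geq u y → Geq u z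

theorem joinGeq_iff {n m k : ℕ} :
    JoinGeq (ones n) (ones m ++ [Digit.two]) (ones k ++ [Digit.two, Digit.two]) ↔
      k + 2 ≤ n ∧ k + 1 ≤ m := by
  constructor
  · intro h
    constructor
    · by_contra! hn
      -- The upper bound `2^(n-1) 1^(m+1) 2` has too few 2s left once the final 2 is cancelled.
      have := h (List.replicate (n - 1) Digit.two ++ ones (m + 1) ++ [Digit.two])
        (by rw [geq_ones]; simp [d]; omega)
        (by rw [add_comm m, ones_add, ← List.append_assoc, List.append_assoc]
            exact geq_append_right _ _)
      rw [← List.singleton_append (l := [Digit.two]), ← List.append_assoc, geq_concat, ones_succ',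
        ← List.append_assoc, geq_concat_of_ne (by decide)] at this
      simp [d, ones, List.count_replicate] at this
      omega
    · by_contra! hn
      have := h (List.replicate (m + 1) Digit.two ++ ones (n + 1))
        (by rw [geq_ones]; simp; omega)
        (geq_of_length_le_d (by simp [d]))
      rw [ones_succ', ← List.append_assoc, ← List.singleton_append (l := [Digit.two]),
        ← List.append_assoc, geq_concat_of_ne (by decide)] at this
      simp [d, ones, List.count_replicate] at this
      omega
  · rintro ⟨h1, h2⟩ u hu hu'
    have := geq_ones_concat_two hu hu'
    exact geq_of_length_le_d (by simp; omega)

/-- `x` is of the form `1^k 2`. -/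
def IsOnesTwo (x : YF) : Prop := Geq x wordTwo ∧ ¬ Geq x [Digit.one, Digit.one]

theorem isOnesTwo_iff {x : YF} : IsOnesTwo x ↔ ∃ k, x = ones k ++ [Digit.two] := by
  rw [IsOnesTwo, geq_wordTwo, show [Digit.one, Digit.one] = ones 2 from rfl, geq_ones]
  constructor
  · rintro ⟨h1, h2⟩
    rcases eq_nil_or_concat_two (y := x) (by omega) with rfl | ⟨z, rfl⟩
    · simp at h1
    · exact ⟨z.length, by rw [← eq_ones_of_d_eq_zero]; simp at h2; omega⟩
  · rintro ⟨k, rfl⟩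
    simp

/-- `x` is of the form `1^k 22`. -/
def IsOnesTwoTwo (x : YF) : Prop :=
  Geq x [Digit.two, Digit.two] ∧ ¬ Geq x [Digit.one, Digit.one, Digit.one] ∧
    ¬ Geq x [Digit.one, Digit.one, Digit.two]

theorem isOnesTwoTwo_iff {x : YF} :
    IsOnesTwoTwo x ↔ ∃ k, x = ones k ++ [Digit.two, Digit.two] := by
  rw [IsOnesTwoTwo, show [Digit.one, Digit.one, Digit.one] = ones 3 from rfl, geq_ones,
    show [Digit.one, Digit.one, Digit.two] = ones 2 ++ [Digit.two] from rfl]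
  constructor
  · rintro ⟨h1, h2, h3⟩
    have h4 := h1.d_le
    simp only [d_cons_two, d_nil] at h4
    rcases eq_nil_or_concat_two (y := x) (by omega) with rfl | ⟨z, rfl⟩
    · simp at h4
    · rw [geq_concat, geq_ones] at h3
      simp at h2 h4
      rcases eq_nil_or_concat_two (y := z) (by omega) with rfl | ⟨z, rfl⟩
      · simp at h4
      · refine ⟨z.length, ?_⟩
        rw [← eq_ones_of_d_eq_zero]
        · simp
        · simp at h2; omega
  · rintro ⟨k, rfl⟩
    refine ⟨geq_append_right _ _, ?_⟩
    rw [← List.singleton_append (l := [Digit.two]), ← List.append_assoc, geq_concat, geq_ones,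
      trailingOnes_concat_two]
    simp

theorem exists_joinGeq_right {n k : ℕ} :
    (∃ y, IsOnesTwo y ∧ JoinGeq (ones n) y (ones k ++ [Digit.two, Digit.two])) ↔ k + 2 ≤ n := by
  constructor
  · rintro ⟨y, hy, h⟩
    obtain ⟨m, rfl⟩ := isOnesTwo_iff.1 hy
    exact (joinGeq_iff.1 h).1
  · intro h
    exact ⟨_, isOnesTwo_iff.2 ⟨k + 1, rfl⟩, joinGeq_iff.2 ⟨h, le_rfl⟩⟩

/-- The thresholds of `joinGeq_iff` turn "at least `k + 2` digits 2" into a statement about `1^k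
22`, which serves as a name for `k`. -/
theorem le_d_iff {u : YF} {k : ℕ} :
    (∃ x y, ¬ Geq x wordTwo ∧ IsOnesTwo y ∧ Geq u x ∧ Geq u y ∧
      JoinGeq x y (ones k ++ [Digit.two, Digit.two])) ↔ k + 2 ≤ d u := by
  constructor
  · rintro ⟨x, y, hx, hy, hux, huy, h⟩
    obtain ⟨m, rfl⟩ := isOnesTwo_iff.1 hy
    rw [geq_wordTwo, not_not] at hx
    rw [eq_ones_of_d_eq_zero hx] at h hux
    have h1 := joinGeq_iff.1 h
    have h2 := geq_ones_concat_two hux huy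
    omega
  · intro h
    refine ⟨ones (k + 2), ones (k + 1) ++ [Digit.two], by simp [geq_wordTwo],
      isOnesTwo_iff.2 ⟨_, rfl⟩, geq_of_length_le_d (by simpa),
      geq_of_length_le_d (by simp; omega), joinGeq_iff.2 (by simp)⟩

theorem eq_ones_d_iff {x u : YF} : x = ones (d u) ↔ ¬ Geq x wordTwo ∧
    (∀ z, IsOnesTwoTwo z → ((∃ x y, ¬ Geq x wordTwo ∧ IsOnesTwo y ∧ Geq u x ∧ Geq u y ∧
      JoinGeq x y z) ↔ ∃ y, IsOnesTwo y ∧ JoinGeq x y z)) ∧ (¬ Geq u wordTwo ↔ x = []) := by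
  simp only [isOnesTwoTwo_iff, forall_exists_index, forall_eq_apply_imp_iff, le_d_iff,
    geq_wordTwo (u := u), not_not]
  constructor
  · rintro rfl
    simp only [exists_joinGeq_right, implies_true, true_and, geq_wordTwo, d_ones]
    simp [← List.length_eq_zero_iff]
  · rintro ⟨h1, h2, h3⟩
    rw [geq_wordTwo, not_not] at h1
    rw [eq_ones_of_d_eq_zero h1] at h2 h3 ⊢
    simp only [exists_joinGeq_right] at h2
    rw [← List.length_eq_zero_iff, length_ones] at h3
    congr 1
    -- Agreement on all thresholds from 2 upwards leaves only 0 and 1 to be told apart, which is the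
    -- role of `h3`.
    have h4 := h2 (x.length - 2)
    have h5 := h2 (d u - 2)
    omega

theorem eq_two_two_iff {x : YF} : x = [Digit.two, Digit.two] ↔
    Geq x [Digit.one, Digit.one] ∧ Geq x [Digit.one, Digit.two] ∧
      JoinGeq [Digit.one, Digit.one] [Digit.one, Digit.two] x := by
  have key : JoinGeq [Digit.one, Digit.one] [Digit.one, Digit.two] [Digit.two, Digit.two] :=
    joinGeq_iff (n := 2) (m := 1) (k := 0) |>.2 (by simp)
  constructor
  · rintro rfl
    exact ⟨geq_of_length_le_d (by simp), geq_of_length_le_d (by simp), key⟩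
  · rintro ⟨h1, h2, h3⟩
    exact (key x h1 h2).antisymm
      (h3 _ (geq_of_length_le_d (by simp)) (geq_of_length_le_d (by simp)))

/-- Choose `u` with last digit different from that of `v`: then nothing cancels. -/
theorem exists_d_eq_not_geq {v : YF} {n : ℕ} (h : n < v.length) : ∃ u, d u = n ∧ ¬ Geq u v := by
  rcases List.eq_nil_or_concat' v with rfl | ⟨v, a, rfl⟩
  · simp at h
  · cases a with
    | one =>
      cases n with
      | zero => exact ⟨[], by simp⟩
      | succ n =>
        refine ⟨List.replicate n Digit.two ++ [Digit.two], by simp [d], ?_⟩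
        rw [geq_concat_of_ne (by decide)]
        simp [d] at h ⊢
        omega
    | two =>
      refine ⟨List.replicate n Digit.two ++ [Digit.one], by simp [d], ?_⟩
      rw [geq_concat_of_ne (by decide)]
      simp [d] at h ⊢
      omega

theorem length_le_iff {v : YF} {n : ℕ} : v.length ≤ n ↔ ∀ u, ones (d u) = ones n → Geq u v := by
  constructor
  · intro h u hu
    exact geq_of_length_le_d (by rwa [ones_injective hu])
  · intro h
    by_contra! hn
    obtain ⟨u, hu, hu'⟩ := exists_d_eq_not_geq hn
    exact hu' (h u (by rw [hu]))

theorem eq_ones_length_iff {v x : YF} : x = ones v.length ↔ ¬ Geq x wordTwo ∧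
    (∀ u, ones (d u) = x → Geq u v) ∧
      ∀ y, ¬ Geq y wordTwo → (∀ u, ones (d u) = y → Geq u v) → Geq y x := by
  constructor
  · rintro rfl
    refine ⟨by simp [geq_wordTwo], length_le_iff.1 le_rfl, fun y hy h => ?_⟩
    rw [geq_wordTwo, not_not] at hy
    rw [eq_ones_of_d_eq_zero hy] at h ⊢
    exact ones_geq_ones.2 (length_le_iff.2 h)
  · rintro ⟨h1, h2, h3⟩
    rw [geq_wordTwo, not_not] at h1
    rw [eq_ones_of_d_eq_zero h1] at h2 h3 ⊢
    have h4 := length_le_iff.2 h2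
    have h5 := h3 (ones v.length) (by simp [geq_wordTwo]) (length_le_iff.1 le_rfl)
    rw [ones_geq_ones] at h5
    rw [h5.antisymm h4]

section

variable {α β : Type}

theorem Def.joinGeq {r s t : (α → YF) → YF} (hr : DefFun r) (hs : DefFun s) (ht : DefFun t) :
    Def fun v => JoinGeq (r v) (s v) (t v) :=
  .all <| .imp (.geq (.var _) (hr.reindex _)) <| .imp (.geq (.var _) (hs.reindex _)) <|
    .geq (.var _) (ht.reindex _)

theorem DefFun.two_two : DefFun fun _ : α → YF => [Digit.two, Digit.two] :=
  have h1 {γ : Type} : DefFun fun _ : γ → YF => [Digit.one, Digit.one] :=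
    DefFun.nil.cons_one.cons_one
  have h2 {γ : Type} : DefFun fun _ : γ → YF => [Digit.one, Digit.two] :=
    DefFun.wordTwo.cons_one
  DefFun.of_def
    (P := fun _ x => Geq x [Digit.one, Digit.one] ∧ Geq x [Digit.one, Digit.two] ∧
      JoinGeq [Digit.one, Digit.one] [Digit.one, Digit.two] x)
    (.and (.geq (.var _) h1) <| .and (.geq (.var _) h2) <| .joinGeq h1 h2 (.var _))
    fun _ _ => eq_two_two_iff

theorem Def.isOnesTwo {t : (α → YF) → YF} (ht : DefFun t) : Def fun v => IsOnesTwo (t v) :=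
  .and (.geq ht .wordTwo) (.not (.geq ht DefFun.nil.cons_one.cons_one))

theorem Def.isOnesTwoTwo {t : (α → YF) → YF} (ht : DefFun t) : Def fun v => IsOnesTwoTwo (t v) :=
  .and (.geq ht .two_two) <| .and (.not (.geq ht DefFun.nil.cons_one.cons_one.cons_one))
    (.not (.geq ht DefFun.wordTwo.cons_one.cons_one))

theorem DefNat.d {t : (α → YF) → YF} (ht : DefFun t) : DefNat fun v => d (t v) := by
  have ht' {γ : Type} (g : α → γ) := ht.reindex g
  refine DefFun.of_def (.and (.not (.geq (.var _) .wordTwo)) <|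
    .and (.all <| .imp (.isOnesTwoTwo (.var _)) <|
    .iff
      (.ex <| .ex <| .and (.not (.geq (.var _) .wordTwo)) <| .and (.isOnesTwo (.var _)) <|
        .and (.geq (ht' fun a => some (some (some (some a)))) (.var _)) <|
        .and (.geq (ht' fun a => some (some (some (some a)))) (.var _)) <|
        .joinGeq (.var _) (.var _) (.var _))
      (.ex <| .and (.isOnesTwo (.var _)) <| .joinGeq (.var _) (.var _) (.var _))) <|
    .iff (.not (.geq (ht' _) .wordTwo)) (.eq (.var _) .nil)) fun _ _ => eq_ones_d_iff

theorem DefNat.length {t : (α → YF) → YF} (ht : DefFun t) : DefNat fun v => (t v).length := by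
  have ht' {γ : Type} (g : α → γ) := ht.reindex g
  refine DefFun.of_def (.and (.not (.geq (.var _) .wordTwo)) <|
    .and (.all <| .imp (.eq (DefNat.d (.var _)) (.var _)) (.geq (.var _) (ht' _))) <|
    .all <| .imp (.not (.geq (.var _) .wordTwo)) <|
      .imp (.all <| .imp (.eq (DefNat.d (.var _)) (.var _)) (.geq (.var _) (ht' _))) <|
      .geq (.var _) (.var _)) fun _ _ => eq_ones_length_iff

end

/-! ### Numbers as definable terms -/

section

variable {α β : Type}

theorem DefNat.reindex {t : (α → YF) → ℕ} (h : DefNat t) (g : α → β) :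
    DefNat fun v : β → YF => t fun a => v (g a) :=
  DefFun.reindex h g

theorem DefNat.zero : DefNat fun _ : α → YF => 0 := DefFun.nil

theorem DefNat.succ {t : (α → YF) → ℕ} (h : DefNat t) : DefNat fun v => t v + 1 :=
  DefFun.cons_one h

theorem Def.natEq {s t : (α → YF) → ℕ} (hs : DefNat s) (ht : DefNat t) :
    Def fun v => s v = t v :=
  (Def.eq hs ht).congr fun _ => ones_injective.eq_iff.symm

theorem Def.natLe {s t : (α → YF) → ℕ} (hs : DefNat s) (ht : DefNat t) :
    Def fun v => s v ≤ t v :=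
  (Def.geq ht hs).congr fun _ => ones_geq_ones.symm

theorem Def.natLt {s t : (α → YF) → ℕ} (hs : DefNat s) (ht : DefNat t) :
    Def fun v => s v < t v :=
  Def.natLe hs.succ ht

/-- Every number is the length of some word, so number quantifiers need no relativization. -/
theorem Def.exNat {P : (α → YF) → ℕ → Prop}
    (h : Def fun v : Option α → YF => P (fun a => v (some a)) (v none).length) :
    Def fun v => ∃ n, P v n :=
  (Def.ex (P := fun v x => P v x.length) h).congr fun v =>
    ⟨fun ⟨n, hn⟩ => ⟨ones n, by simpa⟩, fun ⟨x, hx⟩ => ⟨_, hx⟩⟩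

theorem Def.allNat {P : (α → YF) → ℕ → Prop}
    (h : Def fun v : Option α → YF => P (fun a => v (some a)) (v none).length) :
    Def fun v => ∀ n, P v n :=
  (Def.exNat (P := fun v n => ¬ P v n) h.not).not.congr fun v => by simp

/-- The numerical variable encoded by the length of a word variable is definable. -/
theorem DefNat.var (i : α) : DefNat fun v => (v i).length := .length (.var i)

/-- A number-valued function whose graph is described by a definable relation is definable. -/
theorem DefNat.of_def {P : (α → YF) → ℕ → Prop} {t : (α → YF) → ℕ}
    (h : Def fun v : Option α → YF => P (fun a => v (some a)) (v none).length)
    (e : ∀ v n, n = t v ↔ P v n) : DefNat t :=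
  DefFun.of_def (P := fun v x => ¬ Geq x YoungFibonacci.wordTwo ∧ P v x.length)
    (.and (.not (.geq (.var _) .wordTwo)) h) fun v x => by
      rw [geq_wordTwo, not_not, ← e]
      constructor
      · rintro rfl
        simp
      · rintro ⟨h1, h2⟩
        rw [← h2, ← eq_ones_of_d_eq_zero h1]

end

/-! ### Addition -/

/-- The largest `n` with `u ≥ 1^n`. -/
def reach (u : YF) : ℕ := d u + trailingOnes u

theorem geq_ones_iff_le_reach {u : YF} {n : ℕ} : Geq u (ones n) ↔ n ≤ reach u := geq_ones

theorem eq_reach_iff {u : YF} {n : ℕ} :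
    n = reach u ↔ Geq u (ones n) ∧ ¬ Geq u (ones (n + 1)) := by
  rw [geq_ones_iff_le_reach, geq_ones_iff_le_reach]
  omega

theorem eq_ones_append_two_append_ones {x : YF} {k : ℕ} (h : d x = 1) (h' : reach x = k + 1) :
    ∃ m, x = ones m ++ [Digit.two] ++ ones k := by
  obtain ⟨y, hx, hy⟩ := exists_eq_append_ones x
  have hk : trailingOnes x = k := by rw [reach] at h'; omega
  rw [hk] at hx
  subst hx
  rcases eq_nil_or_concat_two hy with rfl | ⟨z, rfl⟩
  · simp at h
  · refine ⟨z.length, ?_⟩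
    rw [← eq_ones_of_d_eq_zero]
    simpa using h

/-- If `y` did not end in exactly `k` ones, the comparison would meet a mismatch and force `reach y`
to be at least the length of `1^m 2 1^k`. -/
theorem reach_of_geq {y : YF} {m k : ℕ} (h : Geq y (ones m ++ [Digit.two] ++ ones k))
    (h' : reach y < m + 1 + k) : reach y = d y + k := by
  obtain ⟨z, hy, hz⟩ := exists_eq_append_ones y
  rw [reach] at h' ⊢
  generalize trailingOnes y = e at hy h'
  subst hy
  rcases lt_trichotomy e k with hlt | rfl | hlt
  · obtain ⟨r, rfl⟩ := Nat.exists_eq_add_of_lt hlt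
    rw [add_assoc, add_comm, ones_add, ← List.append_assoc, geq_append] at h
    rcases eq_nil_or_concat_two hz with rfl | ⟨w, rfl⟩
    · simp [ones_succ'] at h
    · rw [ones_succ', ← List.append_assoc, geq_concat_of_ne (by decide)] at h
      simp at h h'
      omega
  · rfl
  · obtain ⟨r, rfl⟩ := Nat.exists_eq_add_of_lt hlt
    rw [add_assoc, add_comm, ones_add, ← List.append_assoc, geq_append, ones_succ',
      ← List.append_assoc, geq_concat_of_ne (by decide)] at h
    simp at h h'
    omega

/-- The sum is `reach y` for a word with `a` digits 2 and `k` trailing ones; the auxiliary `x = 1^m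
2 1^k` enforces the latter. Since `y ≥ x` needs a 2 in `y`, the case `a = 0` stands apart. -/
theorem eq_add_iff {a k n : ℕ} : n = a + k ↔ (a = 0 ∧ n = k) ∨ (a ≠ 0 ∧
    ∃ y x, d y = a ∧ reach y = n ∧ d x = 1 ∧ reach x = k + 1 ∧ Geq y x ∧
      reach y < x.length) := by
  rcases Nat.eq_zero_or_pos a with rfl | ha
  · simp
  simp only [ha.ne', false_and, false_or, ne_eq, not_false_iff, true_and]
  constructor
  · rintro rfl
    -- Here `y = 2^(a-1) 1 2 1^k` and `x = 1^a 2 1^k`, whose length exceeds `reach y` by 1.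
    refine ⟨List.replicate (a - 1) Digit.two ++ [Digit.one] ++ ([Digit.two] ++ ones k),
      ones a ++ ([Digit.two] ++ ones k), ?_, ?_, ?_, ?_, ?_, ?_⟩
    · simp [d, ones, List.count_replicate]; omega
    · simp only [reach, ← List.append_assoc, trailingOnes_append_ones, trailingOnes_concat_two]
      simp [d, ones, List.count_replicate]; omega
    · simp
    · simp only [reach, ← List.append_assoc, trailingOnes_append_ones, trailingOnes_concat_two]
      simp; omega
    · rw [geq_append, geq_ones]
      simp [d]; omega
    · simp only [reach, ← List.append_assoc, trailingOnes_append_ones, trailingOnes_concat_two]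
      simp [d, ones, List.count_replicate]; omega
  · rintro ⟨y, x, rfl, rfl, hx, hx', h, hlt⟩
    obtain ⟨m, rfl⟩ := eq_ones_append_two_append_ones hx hx'
    exact reach_of_geq h (by simp at hlt; omega)

/-! ### Reading a digit at a given position -/

theorem exists_eq_ones_append_iff {z w : YF} : (∃ m, z = ones m ++ w) ↔
    Geq z w ∧ ∀ y, Geq z y → Geq y w → y ≠ w → ∃ x, y = Digit.one :: x := by
  constructor
  · rintro ⟨m, rfl⟩
    refine ⟨geq_append_right _ _, fun y h hw hne => ?_⟩
    induction m with
    | zero => exact absurd (hw.antisymm h) hne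
    | succ m ih =>
      rw [ones_succ, List.cons_append, cons_one_geq] at h
      rcases h with rfl | h
      · exact ⟨_, rfl⟩
      · exact ih h
  · rintro ⟨hw, h⟩
    induction z with
    | nil => exact ⟨0, by simp [nil_geq.1 hw]⟩
    | cons a z ih =>
      by_cases hne : a :: z = w
      · exact ⟨0, hne⟩
      · obtain ⟨x, hx⟩ := h _ (.refl _) hw hne
        obtain ⟨rfl, rfl⟩ := List.cons.inj hx
        obtain ⟨m, hm⟩ := ih ((cons_one_geq.1 hw).resolve_left (Ne.symm hne))
          fun y hy => h y (cons_one_geq.2 (.inr hy))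
        exact ⟨m + 1, by rw [ones_succ, List.cons_append, hm]⟩

/-- A mismatch inside `w` would make its unmatched part contain more 2s than digits, so `w` is a
suffix of `u`. The remaining prefix lies above `1^m` with `m` one more than its number of 2s, so it
ends in 1. -/
theorem cons_one_suffix_of_geq {u w : YF} {m : ℕ} : m + d w = d u + 1 → Geq u (ones m ++ w) →
    Digit.one :: w <:+ u := by
  induction u, w using reverse_induction₂ with
  | nil_right u =>
    intro hm h
    simp only [d_nil, List.append_nil, geq_ones] at hm h
    obtain ⟨y, hy, -⟩ := exists_eq_append_ones u
    refine ⟨y ++ ones (trailingOnes u - 1), ?_⟩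
    rw [List.append_assoc, ← ones_succ', Nat.sub_add_cancel (by omega), ← hy]
  | nil_left w a => simp
  | same u w a ih =>
    intro hm h
    rw [← List.append_assoc, geq_concat] at h
    obtain ⟨t, ht⟩ := ih (by simp only [d_append] at hm; omega) h
    exact ⟨t, by rw [← ht]; simp⟩
  | ne u w a c hac =>
    intro hm h
    rw [← List.append_assoc, geq_concat_of_ne hac] at h
    have := d_le_length (w ++ [c])
    simp only [List.length_append, length_ones, List.length_singleton] at h this
    omega

theorem cons_one_suffix_iff {u w : YF} : Digit.one :: w <:+ u ↔
    ∃ z, (∃ m, z = ones m ++ w) ∧ z.length + d w = w.length + (d u + 1) ∧ Geq u z := by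
  constructor
  · rintro ⟨y, rfl⟩
    refine ⟨ones (d y + 1) ++ w, ⟨_, rfl⟩, by simp; omega, ?_⟩
    rw [← List.singleton_append, ← List.append_assoc, geq_append, ones_succ', geq_append]
    exact geq_of_length_le_d (by simp)
  · rintro ⟨_, ⟨m, rfl⟩, h, hu⟩
    exact cons_one_suffix_of_geq (by simp at h; omega) hu

/-- The digit of `u` at the `i`-th position from the right is 2. -/
def TwoAt (u : YF) (i : ℕ) : Prop := u.reverse[i]? = some Digit.two

theorem TwoAt.lt_length {u : YF} {i : ℕ} (h : TwoAt u i) : i < u.length := by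
  obtain ⟨h, -⟩ := List.getElem?_eq_some_iff.1 h
  simpa using h

theorem twoAt_cons_of_lt {u : YF} {a : Digit} {i : ℕ} (h : i < u.length) :
    TwoAt (a :: u) i ↔ TwoAt u i := by
  rw [TwoAt, List.reverse_cons, List.getElem?_append_left (by simpa), TwoAt]

theorem twoAt_cons_length {u : YF} {a : Digit} : TwoAt (a :: u) u.length ↔ a = Digit.two := by
  rw [TwoAt, List.reverse_cons, ← List.length_reverse, List.getElem?_concat_length, Option.some_inj]

theorem twoAt_iff {u : YF} {i : ℕ} : TwoAt u i ↔
    i < u.length ∧ ¬ ∃ w, w.length = i ∧ Digit.one :: w <:+ u := by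
  have key (h : i < u.length) : ∃ t a w, u = t ++ a :: w ∧ w.length = i :=
    ⟨u.take (u.length - 1 - i), u[u.length - 1 - i], u.drop (u.length - i), by
      rw [show u.length - i = u.length - 1 - i + 1 by omega, List.cons_getElem_drop_succ,
        List.take_append_drop], by simp; omega⟩
  have key' (t w : YF) (a : Digit) : TwoAt (t ++ a :: w) w.length ↔ a = Digit.two := by
    rw [TwoAt, List.reverse_append, List.getElem?_append_left (by simp)]
    exact twoAt_cons_length
  constructor
  · refine fun h => ⟨h.lt_length, ?_⟩
    rintro ⟨w, rfl, t, rfl⟩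
    simpa using (key' _ _ _).1 h
  · rintro ⟨h, h'⟩
    obtain ⟨t, a, w, rfl, rfl⟩ := key h
    rw [key']
    cases a with
    | two => rfl
    | one => exact absurd ⟨w, rfl, t, rfl⟩ h'

/-! ### Words as finite sets: counting and divisibility -/

open Classical in
/-- The number of `i < n` satisfying `P`. -/
noncomputable def countBelow (P : ℕ → Prop) (n : ℕ) : ℕ := Nat.count P n

open Classical in
theorem countBelow_succ (P : ℕ → Prop) (n : ℕ) :
    countBelow P (n + 1) = countBelow P n + if P n then 1 else 0 := Nat.count_succ ..

theorem countBelow_congr {P Q : ℕ → Prop} {n : ℕ} (h : ∀ i < n, (P i ↔ Q i)) :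
    countBelow P n = countBelow Q n := by
  induction n with
  | zero => simp [countBelow]
  | succ n ih =>
    rw [countBelow_succ, countBelow_succ, ih fun i hi => h i (by omega), propext (h n (by omega))]

theorem d_eq_countBelow (u : YF) : d u = countBelow (TwoAt u) u.length := by
  induction u with
  | nil => simp [countBelow]
  | cons a u ih =>
    rw [List.length_cons, countBelow_succ, countBelow_congr fun i hi => twoAt_cons_of_lt hi, ← ih,
      twoAt_cons_length]
    cases a <;> simp

theorem exists_twoAt_iff (P : ℕ → Prop) (n : ℕ) :
    ∃ u : YF, u.length = n ∧ ∀ i < n, (TwoAt u i ↔ P i) := by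
  classical
  induction n with
  | zero => exact ⟨[], by simp⟩
  | succ n ih =>
    obtain ⟨u, rfl, h⟩ := ih
    refine ⟨(if P u.length then .two else .one) :: u, rfl, fun i hi => ?_⟩
    rcases Nat.lt_succ_iff_lt_or_eq.1 hi with hi | rfl
    · rw [twoAt_cons_of_lt hi, h i hi]
    · rw [twoAt_cons_length]
      split <;> simp_all

theorem eq_countBelow_iff {P : ℕ → Prop} {n k : ℕ} : k = countBelow P n ↔
    ∃ u : YF, u.length = n ∧ (∀ i, i < n → (TwoAt u i ↔ P i)) ∧ k = d u := by
  constructor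
  · rintro rfl
    obtain ⟨u, rfl, h⟩ := exists_twoAt_iff P n
    exact ⟨u, rfl, h, by rw [d_eq_countBelow, countBelow_congr h]⟩
  · rintro ⟨u, rfl, h, rfl⟩
    rw [d_eq_countBelow, countBelow_congr h]

/-- The word marks the multiples of `a` up to `c`, generated from 0 by steps of `a`. For `a = 0` the
recursion would be circular. -/
theorem dvd_iff_exists_word {a c : ℕ} : a ∣ c ↔ (a = 0 ∧ c = 0) ∨ (a ≠ 0 ∧
    ∃ u : YF, u.length = c + 1 ∧
      (∀ i, i < c + 1 → (TwoAt u i ↔ i = 0 ∨ ∃ j, i = j + a ∧ TwoAt u j)) ∧ TwoAt u c) := by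
  rcases Nat.eq_zero_or_pos a with rfl | ha
  · simp
  simp only [ha.ne', false_and, false_or, ne_eq, not_false_iff, true_and]
  have step (i : ℕ) (h : ¬ i = 0) (h' : a ∣ i) : ∃ j, i = j + a ∧ a ∣ j :=
    ⟨i - a, by have := Nat.le_of_dvd (by omega) h'; omega, Nat.dvd_sub h' dvd_rfl⟩
  constructor
  · intro h
    obtain ⟨u, hu, H⟩ := exists_twoAt_iff (a ∣ ·) (c + 1)
    refine ⟨u, hu, fun i hi => ?_, (H c (by omega)).2 h⟩
    rw [H i hi]
    constructor
    · intro hai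
      by_cases h0 : i = 0
      · exact .inl h0
      · obtain ⟨j, rfl, hj⟩ := step i h0 hai
        exact .inr ⟨j, rfl, (H j (by omega)).2 hj⟩
    · rintro (rfl | ⟨j, rfl, hj⟩)
      · simp
      · exact (Nat.dvd_add_left dvd_rfl).2 ((H j (by omega)).1 hj)
  · rintro ⟨u, -, h, hc⟩
    suffices ∀ i < c + 1, TwoAt u i → a ∣ i from this c (by omega) hc
    intro i
    induction i using Nat.strong_induction_on with
    | _ i ih =>
      intro hi h2
      rcases (h i hi).1 h2 with rfl | ⟨j, rfl, hj⟩
      · simp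
      · exact (Nat.dvd_add_left dvd_rfl).2 (ih j (by omega) (by omega) hj)

section

variable {α β : Type}

theorem DefNat.reach {t : (α → YF) → YF} (ht : DefFun t) : DefNat fun v => reach (t v) :=
  have ht' := ht.reindex some
  DefNat.of_def (.and (.geq ht' (DefNat.var _)) (.not (.geq ht' (DefNat.var _).succ)))
    fun _ _ => eq_reach_iff

theorem DefNat.add {s t : (α → YF) → ℕ} (hs : DefNat s) (ht : DefNat t) :
    DefNat fun v => s v + t v := by
  have hs' {γ : Type} (g : α → γ) := hs.reindex g
  have ht' {γ : Type} (g : α → γ) := ht.reindex g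
  refine DefNat.of_def (.or (.and (.natEq (hs' _) .zero) (.natEq (.var _) (ht' _))) <|
    .and (.not (.natEq (hs' _) .zero)) <| .ex <| .ex <|
    .and (.natEq (.d (.var _)) (hs' fun a => some (some (some a)))) <|
    .and (.natEq (.reach (.var _)) (.var _)) <|
    .and (.natEq (.d (.var _)) (DefNat.zero.succ)) <|
    .and (.natEq (.reach (.var _)) (ht' fun a => some (some (some a))).succ) <|
    .and (.geq (.var _) (.var _)) (.natLt (.reach (.var _)) (.var _))) fun _ _ => eq_add_iff

theorem Def.cons_one_suffix {s t : (α → YF) → YF} (hs : DefFun s) (ht : DefFun t) :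
    Def fun v => Digit.one :: s v <:+ t v := by
  have hs' {γ : Type} (g : α → γ) := hs.reindex g
  refine Def.congr (.ex <| .and
    (.congr (.and (.geq (.var _) (hs' _)) <| .all <| .imp (.geq (.var _) (.var _)) <|
      .imp (.geq (.var _) (hs' fun a => some (some a))) <|
      .imp (.ne (.var _) (hs' fun a => some (some a))) <| .ex <| .eq (.var _) (.cons_one (.var _)))
      fun _ => exists_eq_ones_append_iff) <|
    .and (.natEq (.add (.var _) (.d (hs' _)))
      (.add (.length (hs' _)) (.succ (.d (ht.reindex _))))) <|
    .geq (ht.reindex _) (.var _)) fun _ => cons_one_suffix_iff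

theorem Def.twoAt {s : (α → YF) → YF} {t : (α → YF) → ℕ} (hs : DefFun s) (ht : DefNat t) :
    Def fun v => TwoAt (s v) (t v) :=
  Def.congr (.and (.natLt ht (.length hs)) <| .not <| .ex <|
    .and (.natEq (.var _) (ht.reindex _)) <|
    .cons_one_suffix (.var _) (hs.reindex _)) fun _ => twoAt_iff

theorem DefNat.countBelow {P : (α → YF) → ℕ → Prop} {t : (α → YF) → ℕ}
    (h : Def fun v : Option α → YF => P (fun a => v (some a)) (v none).length) (ht : DefNat t) :
    DefNat fun v => countBelow (P v) (t v) := by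
  have ht' {γ : Type} (g : α → γ) := ht.reindex g
  refine DefNat.of_def (.ex <| .and (.natEq (.var _) (ht' fun a => some (some a))) <| .and
    (.allNat <| .imp (.natLt (.var _) (ht' fun a => some (some (some a)))) <|
      .iff (.twoAt (.var _) (.var _))
        (h.reindex (fun o => o.elim none fun a => some (some (some a)))))
    (.natEq (.var _) (.d (.var _)))) fun _ _ => eq_countBelow_iff

theorem Def.dvd {s t : (α → YF) → ℕ} (hs : DefNat s) (ht : DefNat t) :
    Def fun v => s v ∣ t v := by
  have hs' {γ : Type} (g : α → γ) := hs.reindex g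
  have ht' {γ : Type} (g : α → γ) := ht.reindex g
  refine Def.congr (.or (.and (.natEq hs .zero) (.natEq ht .zero)) <|
    .and (.not (.natEq hs .zero)) <| .ex <| .and (.natEq (.var _) (ht' _).succ) <|
    .and (.allNat <| .imp (.natLt (.var _) (ht' fun a => some (some a)).succ) <|
      .iff (.twoAt (.var _) (.var _)) <| .or (.natEq (.var _) .zero) <| .exNat <|
      .and (.natEq (.var _) (.add (.var _) (hs' fun a => some (some (some a))))) <|
      .twoAt (.var _) (.var _)) <|
    .twoAt (.var _) (ht' _)) fun _ => dvd_iff_exists_word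

end

/-! ### Run lengths -/

theorem countBelow_mono (P : ℕ → Prop) : Monotone (countBelow P) := by
  classical
  exact Nat.count_monotone P

@[simp] theorem countBelow_zero (P : ℕ → Prop) : countBelow P 0 = 0 := by
  classical
  exact Nat.count_zero _

@[simp] theorem countBelow_false (n : ℕ) : countBelow (fun _ => False) n = 0 := by
  induction n with
  | zero => simp
  | succ n ih => rw [countBelow_succ, ih, if_neg id]

theorem countBelow_twoAt_le {u : YF} {j : ℕ} (h : j ≤ u.length) : countBelow (TwoAt u) j ≤ d u := by
  rw [d_eq_countBelow]
  exact countBelow_mono _ h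

/-- The ones of the `i`-th run are those with exactly `i` digits 2 to their left, that is, `d u - i`
to their right. -/
theorem run_eq_countBelow (u : YF) (i : ℕ) : run u i =
    countBelow (fun j => ¬ TwoAt u j ∧ countBelow (TwoAt u) j + i = d u) u.length := by
  induction u generalizing i with
  | nil => simp [run]
  | cons a u ih =>
    have key (j : ℕ) (hj : j ≤ u.length) :
        countBelow (TwoAt (a :: u)) j = countBelow (TwoAt u) j :=
      countBelow_congr fun k hk => twoAt_cons_of_lt (by omega)
    rw [List.length_cons, countBelow_succ, key _ le_rfl, twoAt_cons_length, ← d_eq_countBelow]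
    cases a with
    | one =>
      rw [countBelow_congr (Q := fun j => ¬ TwoAt u j ∧ countBelow (TwoAt u) j + i = d u)
        fun j hj => by rw [twoAt_cons_of_lt hj, key j hj.le, d_cons_one], ← ih]
      cases i <;> simp [run]
    | two =>
      rw [if_neg (by simp), add_zero]
      cases i with
      | zero =>
        rw [countBelow_congr (Q := fun _ => False) fun j hj => by
          have := countBelow_twoAt_le hj.le
          rw [key j hj.le, d_cons_two, iff_false]
          omega]
        simp [run]
      | succ i =>
        rw [countBelow_congr (Q := fun j => ¬ TwoAt u j ∧ countBelow (TwoAt u) j + i = d u)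
          fun j hj => by rw [twoAt_cons_of_lt hj, key j hj.le, d_cons_two, ← add_assoc,
            add_left_inj], ← ih, run]

theorem run_eq_zero_of_lt {u : YF} {i : ℕ} (h : d u < i) : run u i = 0 := by
  rw [run_eq_countBelow, countBelow_congr (Q := fun _ => False) fun j _ => by
    rw [iff_false]; omega]
  exact countBelow_false _

theorem run_zero_of_d_eq_zero {u : YF} (h : d u = 0) : run u 0 = u.length := by
  induction u with
  | nil => rfl
  | cons a u ih =>
    cases a with
    | one => rw [run, ih (by simpa using h), List.length_cons]
    | two => simp at h

theorem run_ones_append_zero (n : ℕ) (u : YF) : run (ones n ++ u) 0 = n + run u 0 := by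
  induction n with
  | zero => simp
  | succ n ih => rw [ones_succ, List.cons_append, run, ih]; omega

theorem run_ones_append_succ (n : ℕ) (u : YF) (i : ℕ) :
    run (ones n ++ u) (i + 1) = run u (i + 1) := by
  induction n with
  | zero => simp
  | succ n ih => rw [ones_succ, List.cons_append, run, ih]

theorem eq_of_run_eq {u v : YF} (hd : d u = d v) (h : ∀ i, run u i = run v i) : u = v := by
  rw [eq_runs u, eq_runs v, hd]
  simp only [h]

theorem exists_run_eq (D : ℕ) (r : ℕ → ℕ) : ∃ u, d u = D ∧ ∀ i ≤ D, run u i = r i := by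
  induction D generalizing r with
  | zero => exact ⟨ones (r 0), by simp, fun i hi => by
      rw [Nat.le_zero.1 hi, run_zero_of_d_eq_zero (by simp), length_ones]⟩
  | succ D ih =>
    obtain ⟨u, hu, H⟩ := ih fun i => r (i + 1)
    refine ⟨ones (r 0) ++ Digit.two :: u, by simp [hu], fun i hi => ?_⟩
    cases i with
    | zero => rw [run_ones_append_zero, run, add_zero]
    | succ i => rw [run_ones_append_succ, run, H i (by omega)]

/-! ### Prime factorization of `b` and bijectivity -/

/-- The exponent of the prime `p i` in `b u`, for nonempty `u`. -/
def exponent (u : YF) (i : ℕ) : ℕ :=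
  if i = d u then if d u = 0 then run u i - 1 else run u i + 1 else run u i

theorem exponent_eq_zero_of_lt {u : YF} {i : ℕ} (h : d u < i) : exponent u i = 0 := by
  rw [exponent, if_neg h.ne', run_eq_zero_of_lt h]

theorem p_zero : p 0 = 2 := Nat.nth_prime_zero_eq_two

theorem prime_p (i : ℕ) : (p i).Prime := Nat.prime_nth_prime i

theorem p_strictMono : StrictMono p := Nat.nth_strictMono Nat.infinite_setOfPred_prime

theorem countBelow_prime_p (i : ℕ) : countBelow Nat.Prime (p i) = i := by
  rw [countBelow, p]
  exact @Nat.count_nth_of_infinite _ (_) Nat.infinite_setOfPred_prime i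

theorem p_countBelow_prime {q : ℕ} (hq : q.Prime) : p (countBelow Nat.Prime q) = q := by
  rw [countBelow, p]
  exact @Nat.nth_count _ (_) _ hq

theorem b_nil : b [] = 0 := by simp [b]

theorem b_eq_prod {u : YF} (hu : u ≠ []) :
    b u = ∏ i ∈ Finset.range (d u + 1), p i ^ exponent u i := by
  rw [b, if_neg hu, Finset.prod_range_succ]
  split_ifs with h
  · simp [h, exponent, run_zero_of_d_eq_zero h, p_zero]
  · rw [mul_comm]
    congr 1
    · refine Finset.prod_congr rfl fun i hi => ?_
      rw [exponent, if_neg (Finset.mem_range.1 hi).ne]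
    · rw [exponent, if_pos rfl, if_neg h]

theorem prod_p_pow_ne_zero (e : ℕ → ℕ) (N : ℕ) : ∏ i ∈ Finset.range N, p i ^ e i ≠ 0 :=
  Finset.prod_ne_zero_iff.2 fun i _ => pow_ne_zero _ (prime_p i).ne_zero

theorem factorization_prod_p_pow (e : ℕ → ℕ) (N j : ℕ) :
    (∏ i ∈ Finset.range N, p i ^ e i).factorization (p j) = if j < N then e j else 0 := by
  induction N with
  | zero => simp
  | succ N ih =>
    rw [Finset.prod_range_succ, Nat.factorization_mul (prod_p_pow_ne_zero e N)
      (pow_ne_zero _ (prime_p N).ne_zero), Finsupp.add_apply, ih,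
      (prime_p N).factorization_pow, Finsupp.single_apply]
    simp only [p_strictMono.injective.eq_iff]
    split_ifs <;> first | omega | (subst_vars; omega)

theorem b_ne_zero {u : YF} (hu : u ≠ []) : b u ≠ 0 := by
  rw [b_eq_prod hu]
  exact prod_p_pow_ne_zero _ _

theorem factorization_b {u : YF} (hu : u ≠ []) (i : ℕ) :
    (b u).factorization (p i) = exponent u i := by
  rw [b_eq_prod hu, factorization_prod_p_pow]
  split_ifs with h
  · rfl
  · rw [exponent_eq_zero_of_lt (by omega)]

theorem eq_of_factorization_p_eq {m n : ℕ} (hm : m ≠ 0) (hn : n ≠ 0)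
    (h : ∀ i, m.factorization (p i) = n.factorization (p i)) : m = n :=
  Nat.eq_of_factorization_eq hm hn fun q => by
    by_cases hq : q.Prime
    · rw [← p_countBelow_prime hq, h]
    · rw [Nat.factorization_eq_zero_of_not_prime _ hq, Nat.factorization_eq_zero_of_not_prime _ hq]

theorem d_le_of_exponent_eq {u v : YF} (h : exponent u = exponent v) : d u ≤ d v := by
  by_contra! hlt
  have h1 := exponent_eq_zero_of_lt hlt
  rw [← h, exponent, if_pos rfl, if_neg (by omega)] at h1
  omega

theorem eq_of_exponent_eq {u v : YF} (hu : u ≠ []) (hv : v ≠ []) (h : exponent u = exponent v) :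
    u = v := by
  have hd : d u = d v := (d_le_of_exponent_eq h).antisymm (d_le_of_exponent_eq h.symm)
  refine eq_of_run_eq hd fun i => ?_
  have hi := congrFun h i
  rw [exponent, exponent, hd] at hi
  split_ifs at hi with h1 h2
  · subst h1
    have hd' := hd.trans h2
    rw [h2] at hi ⊢
    rw [run_zero_of_d_eq_zero hd', run_zero_of_d_eq_zero h2] at hi ⊢
    have h3 := List.length_pos_iff.2 hu
    have h4 := List.length_pos_iff.2 hv
    omega
  · omega
  · exact hi

theorem exists_exponent_eq {n : ℕ} (hn : n ≠ 0) :
    ∃ u ≠ [], ∀ i, exponent u i = n.factorization (p i) := by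
  classical
  set e : ℕ → ℕ := fun i => n.factorization (p i) with he
  -- The bound `n` suffices because `i ≤ p i ≤ n` whenever `p i` divides `n`. The default value 0
  -- covers `n = 1`, so `D = 0` means a power of 2.
  set D := Nat.findGreatest (fun i => e i ≠ 0) n with hD
  have hbound (i : ℕ) (hi : e i ≠ 0) : i ≤ n :=
    p_strictMono.le_apply.trans
      (Nat.le_of_dvd (Nat.pos_of_ne_zero hn) (Nat.dvd_of_factorization_pos hi))
  have hgt (i : ℕ) (hi : D < i) : e i = 0 := by
    by_contra h
    exact Nat.findGreatest_is_greatest hi (hbound i h) h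
  have hD0 (h : D ≠ 0) : e D ≠ 0 := Nat.findGreatest_of_ne_zero (P := fun i => e i ≠ 0) hD.symm h
  obtain ⟨u, hu, hr⟩ := exists_run_eq D
    fun i => if i = D then if D = 0 then e i + 1 else e i - 1 else e i
  refine ⟨u, ?_, fun i => ?_⟩
  · rintro rfl
    have h0 : D = 0 := hu.symm
    have := hr 0 (by omega)
    simp [h0, run] at this
  · change exponent u i = e i
    rcases lt_or_ge D i with h | h
    · rw [hgt i h, exponent_eq_zero_of_lt (by omega)]
    · rw [exponent, hu, hr i h]
      by_cases h1 : i = D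
      · subst h1
        by_cases h2 : D = 0
        · simp [h2]
        · have := hD0 h2
          simp [h2]; omega
      · simp [h1]

theorem b_bijective : Function.Bijective b := by
  constructor
  · intro u v h
    by_cases hu : u = []
    · by_contra hv
      exact b_ne_zero (u := v) (by rintro rfl; exact hv hu) (by rw [← h, hu, b_nil])
    by_cases hv : v = []
    · exact absurd (by rw [h, hv, b_nil]) (b_ne_zero hu)
    exact eq_of_exponent_eq hu hv (funext fun i => by
      rw [← factorization_b hu, ← factorization_b hv, h])
  · intro n
    by_cases hn : n = 0
    · exact ⟨[], by rw [hn, b_nil]⟩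
    · obtain ⟨u, hu, h⟩ := exists_exponent_eq hn
      exact ⟨u, eq_of_factorization_p_eq (b_ne_zero hu) hn fun i => by
        rw [factorization_b hu, h]⟩

/-! ### Definability of `b` -/

/-- The numbers counted are the powers of `q` dividing `n`, including `q ^ 0`, whence the `+ 1`. -/
theorem countBelow_prime_power_dvd {n q : ℕ} (hn : n ≠ 0) (hq : q.Prime) :
    countBelow (fun j => j ∣ n ∧ ∀ k, k ∣ j → k = 1 ∨ q ∣ k) (n + 1) = n.factorization q + 1 := by
  classical
  rw [countBelow, Nat.count_eq_card_filter_range,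
    show n.factorization q + 1 = (Finset.range (n.factorization q + 1)).card by simp,
    ← Finset.card_image_of_injective (Finset.range (n.factorization q + 1))
      (Nat.pow_right_injective hq.two_le)]
  congr 1
  ext j
  simp only [Finset.mem_filter, Finset.mem_range, Finset.mem_image]
  constructor
  · rintro ⟨-, hj, h⟩
    have := Nat.eq_prime_pow_of_unique_prime_dvd (p := q) (n := j)
      (by rintro rfl; exact hn (Nat.eq_zero_of_zero_dvd hj)) fun {r} hr hrj =>
        ((Nat.prime_dvd_prime_iff_eq hq hr).1 ((h r hrj).resolve_left hr.ne_one)).symm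
    refine ⟨_, ?_, this.symm⟩
    rw [this] at hj
    exact Nat.lt_succ_of_le ((hq.pow_dvd_iff_le_factorization hn).1 hj)
  · rintro ⟨i, hi, rfl⟩
    have hdvd := (hq.pow_dvd_iff_le_factorization hn).2 (Nat.lt_succ_iff.1 hi)
    refine ⟨Nat.lt_succ_of_le (Nat.le_of_dvd (Nat.pos_of_ne_zero hn) hdvd), hdvd, fun k hk => ?_⟩
    obtain ⟨m, -, rfl⟩ := (Nat.dvd_prime_pow hq).1 hk
    cases m with
    | zero => simp
    | succ m => exact .inr (dvd_pow_self q (by omega))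

/-- Here `c` is the exponent of `q` in `n` plus 1. This shift also absorbs the subtraction in the
exponent of `1^n`. -/
theorem eq_b_iff {u : YF} {n : ℕ} : n = b u ↔ (u = [] ∧ n = 0) ∨ (u ≠ [] ∧ n ≠ 0 ∧
    ∀ q, Nat.Prime q → ∃ i c, i = countBelow Nat.Prime q ∧
      c = countBelow (fun j => j ∣ n ∧ ∀ k, k ∣ j → k = 1 ∨ q ∣ k) (n + 1) ∧
      (i ≠ d u → c = run u i + 1) ∧ (i = d u → d u = 0 → c = run u i) ∧
      (i = d u → d u ≠ 0 → c = run u i + 1 + 1)) := by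
  by_cases hu : u = []
  · simp [hu, b_nil]
  by_cases hn : n = 0
  · simp [hn, hu, (b_ne_zero hu).symm]
  simp only [hu, hn, false_and, false_or, ne_eq, not_false_iff, true_and]
  have key (i : ℕ) : n.factorization (p i) = exponent u i ↔
      (i ≠ d u → n.factorization (p i) + 1 = run u i + 1) ∧
      (i = d u → d u = 0 → n.factorization (p i) + 1 = run u i) ∧
      (i = d u → d u ≠ 0 → n.factorization (p i) + 1 = run u i + 1 + 1) := by
    rw [exponent]
    split_ifs with h1 h2
    · have h3 := run_zero_of_d_eq_zero h2
      have h4 := List.length_pos_iff.2 hu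
      rw [← h2, ← h1] at h3
      simp [h1, h2] at h3 ⊢
      omega
    · simp [h1, h2]
    · simp [h1]
  constructor
  · rintro rfl q hq
    refine ⟨_, _, rfl, rfl, ?_⟩
    rw [countBelow_prime_power_dvd (b_ne_zero hu) hq]
    have := (key (countBelow Nat.Prime q))
    rw [p_countBelow_prime hq] at this
    exact this.1 (by conv_lhs => rw [← p_countBelow_prime hq]
                     exact factorization_b hu _)
  · intro h
    refine eq_of_factorization_p_eq hn (b_ne_zero hu) fun i => ?_
    obtain ⟨_, _, rfl, rfl, H⟩ := h (p i) (prime_p i)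
    rw [countBelow_prime_power_dvd hn (prime_p i), countBelow_prime_p] at H
    rw [(key i).2 H, factorization_b hu]

section

variable {α : Type}

theorem Def.prime {t : (α → YF) → ℕ} (ht : DefNat t) : Def fun v => Nat.Prime (t v) :=
  Def.congr (.and (.natLe DefNat.zero.succ.succ ht) <| .allNat <|
    .imp (.dvd (.var _) (ht.reindex _)) <|
    .or (.natEq (.var _) DefNat.zero.succ) (.natEq (.var _) (ht.reindex _))) fun _ => Nat.prime_def

theorem DefNat.run {s : (α → YF) → YF} {t : (α → YF) → ℕ} (hs : DefFun s) (ht : DefNat t) :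
    DefNat fun v => run (s v) (t v) :=
  DefFun.congr (DefNat.countBelow
    (P := fun v j => ¬ TwoAt (s v) j ∧
      YoungFibonacci.countBelow (TwoAt (s v)) j + t v = YoungFibonacci.d (s v))
    (.and (.not (.twoAt (hs.reindex _) (.var _))) <|
      .natEq (.add (.countBelow (P := fun v i => TwoAt (s fun a => v (some a)) i)
        (.twoAt (hs.reindex fun a => some (some a)) (.var _)) (.var _)) (ht.reindex _))
        (.d (hs.reindex _)))
    (.length hs)) fun _ => congrArg ones (run_eq_countBelow _ _)

theorem DefNat.b {t : (α → YF) → YF} (ht : DefFun t) : DefNat fun v => b (t v) := by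
  have ht' {γ : Type} (g : α → γ) := ht.reindex g
  have hd {γ : Type} (g : α → γ) := DefNat.d (ht' g)
  have hrun {γ : Type} (g : α → γ) (i : γ) := DefNat.run (ht' g) (.var i)
  refine DefNat.of_def (.or (.and (.eq (ht' _) .nil) (.natEq (.var _) .zero)) <|
    .and (.ne (ht' _) .nil) <| .and (.not (.natEq (.var _) .zero)) <| .allNat <|
    .imp (.prime (.var _)) <| .exNat <| .exNat <|
    .and (.natEq (.var _) (.countBelow (P := fun _ => Nat.Prime) (.prime (.var _)) (.var _))) <|
    .and (.natEq (.var _) (.countBelow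
      (P := fun v j => j ∣ (v (some (some (some none)))).length ∧
        ∀ k, k ∣ j → k = 1 ∨ (v (some (some none))).length ∣ k)
      (.and (.dvd (.var _) (.var _)) <| .allNat <| .imp (.dvd (.var _) (.var _)) <|
        .or (.natEq (.var _) DefNat.zero.succ) (.dvd (.var _) (.var _)))
      (.succ (.var _)))) <|
    .and (.imp (.not (.natEq (.var _) (hd fun a => some (some (some (some a))))))
      (.natEq (.var _) (.succ (hrun (fun a => some (some (some (some a)))) _)))) <|
    .and (.imp (.natEq (.var _) (hd fun a => some (some (some (some a))))) <|
      .imp (.natEq (hd fun a => some (some (some (some a)))) .zero)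
        (.natEq (.var _) (hrun (fun a => some (some (some (some a)))) _))) <|
    .imp (.natEq (.var _) (hd fun a => some (some (some (some a))))) <|
      .imp (.not (.natEq (hd fun a => some (some (some (some a)))) .zero))
        (.natEq (.var _) (.succ (.succ (hrun (fun a => some (some (some (some a)))) _)))))
    fun _ _ => eq_b_iff

end

theorem Def.definable {α : Type} {P : (α → YF) → Prop} (h : Def P) :
    (∅ : Set YF).Definable starLanguage {v | P v} := by
  obtain ⟨φ, hφ⟩ := h
  exact Set.empty_definable_iff.2 ⟨φ, Set.ext fun v => (hφ v).symm⟩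

end YoungFibonacci

theorem mainTheorem4 :
    Function.Bijective YoungFibonacci.b ∧
      Set.Definable₂ (∅ : Set YoungFibonacci.YF) YoungFibonacci.starLanguage
        {x : YoungFibonacci.YF × YoungFibonacci.YF |
          x.2 = YoungFibonacci.ones (YoungFibonacci.b x.1)} :=
  ⟨YoungFibonacci.b_bijective, YoungFibonacci.Def.definable
    (YoungFibonacci.Def.eq (.var 1) (YoungFibonacci.DefNat.b (.var (0 : Fin 2))))⟩
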